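/- **Setting.** Let $\Phi$ (fields) and $\mathfrak J$ (sources) be real vector spaces with a bilinear duality $\langle\varphi,J\rangle$, and give $\Phi$ the $\sigma$-algebra generated by the functions $\varphi\mapsto\langle\varphi,J\rangle$, $J\in\mathfrak J$. Let $(e_x)_{x\in\Lambda}$ be a countable family in $\mathfrak J$, write $\varphi_x=\langle\varphi,e_x\rangle$, and sum repeated indices over $\Lambda$. (For finite $\Lambda$: $\Phi=\mathfrak J=\mathbb R^\Lambda$ and $e_x$ the Kronecker deltas; for tempered distributions: Schwartz sources and the Hermite basis.) Functional derivatives are directional derivatives: $\partial_hZ[J]=\frac{d}{dt}Z[J+th]|_{t=0}$ and $\frac{\delta}{\delta J^x}=\partial_{e_x}$. Let $L:\operatorname{dom}L\subseteq\Phi\to\mathfrak J$ be a linear symmetric operator ($\langle\varphi,L\psi\rangle=\langle\psi,L\varphi\rangle$) with everywhere defined inverse $G:\mathfrak J\to\operatorname{dom}L$. Let $\gamma$ be the Gaussian measure with $\int e^{\langle\varphi,J\rangle}d\gamma=\exp\{\tfrac12\langle GJ,J\rangle\}<\infty$ for all $J$. Let $$S_I[\varphi]=\sum_{n\ge0}\tfrac1{n!}v^{y_1\cdots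 y_n}\varphi_{y_1}\cdots\varphi_{y_n}$$ with real, completely symmetric coefficients, such that $\sum_n\frac1{n!}\sum_{y}|v^{y_1\cdots y_n}|\prod_j(|\varphi_{y_j}|+|\psi_{y_j}|)<\infty$ for all $\varphi,\psi\in\Phi$. Assume $\Xi=\int e^{S_I}d\gamma<\infty$ and put $d\mu=\Xi^{-1}e^{S_I}d\gamma$. Assume that $Z[J]=\int e^{\langle\varphi,J\rangle}d\mu<\infty$ for all $J\in\mathfrak J$, and write $\langle\cdot\rangle$ for the expectation under $\mu$. For $k\in\Phi$ put $k_xF_I^x[\varphi]=\sum_{n}\frac1{n!}v^{xy_1\cdots y_n}k_x\varphi_{y_1}\cdots\varphi_{y_n}$. Say that $k$ satisfies (C) if for every $J$ this expansion converges absolutely in mean against $e^{\langle\varphi,J\rangle}\mu$: for each $n$, $\sum_{x,y}\langle|v^{xy_1\cdots y_n}k_x\varphi_{y_1}\cdots\varphi_{y_n}|e^{\langle\varphi,J\rangle}\rangle<\infty$, and $\sum_n\frac1{n!}\langle|v^{xy_1\cdots y_n}k_x\varphi_{y_1}\cdots\varphi_{y_n}|e^{\langle\varphi,J\rangle}\rangle<\infty$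 (where in the second condition $x,y$ are summed inside the absolute value). **Theorem (Dyson–Schwinger).** 1. $k_xF_I^x[\varphi]$ is the derivative of $S_I$ at $\varphi$ in direction $k$, for all $\varphi,k\in\Phi$; and for $\varphi,k\in\operatorname{dom}L$ the derivative of the total action $S[\varphi]=-\frac12\langle\varphi,L\varphi\rangle+S_I[\varphi]$ at $\varphi$ in direction $k$ is $k_xF^x[\varphi]:=-\langle\varphi,Lk\rangle+k_xF_I^x[\varphi]$ (that is, $F^x=-g^{xy}\varphi_y+F_I^x$). 2. All iterated functional derivatives of $Z$ exist everywhere, and all moments of $\mu$ exist. If $\Lambda$ is finite and only finitely many of the tensors $v^{y_1\cdots y_n}$ are nonzero, then every $k\in\Phi$ satisfies (C). 3. For every $k\in\operatorname{dom}L$ satisfying (C) and every $J\in\mathfrak J$, $\ k_x\{F^x[\tfrac{\delta}{\delta J}]+J^x\}Z[J]=0$, i.e. $$-\partial_{Lk}Z[J]+\sum_{n\ge0}\tfrac1{n!}\,v^{xy_1\cdots y_n}k_x\frac{\delta^nZ[J]}{\delta J^{y_1}\cdots\delta J^{y_n}}+\langle k,J\rangle Z[J]=0,$$ where the sum over $x,y$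 for each $n$ and the sum over $n$ converge absolutely. (For finite $\Lambda$, taking $k$ the Kronecker delta at $x$ gives $\{F^x[\frac{\delta}{\delta J}]+J^x\}Z[J]=0$ for each $x\in\Lambda$.) 4. For every $h\in\mathfrak J$ such that $Gh$ satisfies (C), and all $K_1,\dots,K_m\in\mathfrak J$, $m\ge0$, with $\varphi(K)=\langle\varphi,K\rangle$, $$\Big\langle\varphi(h)\prod_{i=1}^m\varphi(K_i)\Big\rangle=\sum_{i=1}^m\langle Gh,K_i\rangle\Big\langle\prod_{j\ne i}\varphi(K_j)\Big\rangle+\sum_{n\ge0}\tfrac1{n!}\,(Gh)_y\,v^{yy_1\cdots y_n}\Big\langle\varphi_{y_1}\cdots\varphi_{y_n}\prod_{i=1}^m\varphi(K_i)\Big\rangle,$$ the series converging absolutely as in 3. (For $h=e_x$, $K_i=e_{x_i}$ and $g_{xy}=\langle Ge_x,e_y\rangle$ this is $\langle\varphi_x\varphi_{x_1}\cdots\varphi_{x_m}\rangle=\sum_ig_{xx_i}\langle\prod_{j\ne i}\varphi_{x_j}\rangle+g_{xy}\sum_n\frac1{n!}v^{yy_1\cdots y_n}\langle\varphi_{y_1}\cdots\varphi_{y_n}\varphi_{x_1}\cdots\varphi_{x_m}\rangle$.)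 -/

import Mathlib

open MeasureTheory

/-!  Fields and sources.  `Φ` is the space of field realizations, `𝔍` the space of sources, and
`B φ J` is the duality `⟨φ, J⟩ = φ_x J^x`.  Components are taken relative to a countable family of
sources `e x`, `x : Λ`: the field has components `φ_x = B φ (e x)`, and repeated indices are summed
over `Λ`.  For a finite set `Λ` one takes `Φ = 𝔍 = (Λ → ℝ)` and `e x` the Kronecker delta at `x`;
for tempered distributions one takes Schwartz functions as sources and `e` the Hermite basis. -/

namespace FieldTheory

noncomputable section

variable {Φ 𝔍 Λ : Type*} [AddCommGroup Φ] [Module ℝ Φ] [AddCommGroup 𝔍] [Module ℝ 𝔍]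

/-- The sigma-algebra on the space of fields generated by the functions `φ ↦ ⟨φ, J⟩`. -/
abbrev cylinderSigmaAlgebra (B : Φ →ₗ[ℝ] 𝔍 →ₗ[ℝ] ℝ) : MeasurableSpace Φ :=
  ⨆ J : 𝔍, MeasurableSpace.comap (fun φ => B φ J) inferInstance

/-- `G : 𝔍 → Φ` is the (everywhere defined) inverse of the operator `L`, which is defined on the
subspace `L.domain` of `Φ`: the equation `L φ = J` has the unique solution `φ = G J`. -/
structure IsInverseOperator (L : Φ →ₗ.[ℝ] 𝔍) (G : 𝔍 →ₗ[ℝ] Φ) : Prop where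
  mem_domain : ∀ J, G J ∈ L.domain
  apply_inverse : ∀ J, L ⟨G J, mem_domain J⟩ = J
  inverse_apply : ∀ φ : L.domain, G (L φ) = φ

/-- Symmetry of `L`: `⟨φ, L ψ⟩ = ⟨ψ, L φ⟩`. -/
def IsSymmetricOperator (B : Φ →ₗ[ℝ] 𝔍 →ₗ[ℝ] ℝ) (L : Φ →ₗ.[ℝ] 𝔍) : Prop :=
  ∀ φ ψ : L.domain, B φ (L ψ) = B ψ (L φ)

/-- The generating functional `Z[J] = ∫ exp ⟨φ, J⟩ dν(φ)`. -/
def genFun (B : Φ →ₗ[ℝ] 𝔍 →ₗ[ℝ] ℝ) [MeasurableSpace Φ] (ν : Measure Φ) (J : 𝔍) : ℝ :=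
  ∫ φ, Real.exp (B φ J) ∂ν

/-- `γ` is the Gaussian state with covariance `G`:
`Z_γ[J] = exp (½ ⟨G J, J⟩) = exp (½ g_{xy} J^x J^y)` for every source `J`. -/
def IsGaussianState (B : Φ →ₗ[ℝ] 𝔍 →ₗ[ℝ] ℝ) (G : 𝔍 →ₗ[ℝ] Φ) [MeasurableSpace Φ]
    (γ : Measure Φ) : Prop :=
  ∀ J, Integrable (fun φ => Real.exp (B φ J)) γ ∧
    genFun B γ J = Real.exp ((1 / 2) * B (G J) J)

/-- The iterated functional derivative `δⁿ / δh₁ ⋯ δhₙ` of a functional of the source in the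
directions `h 0, …, h (n - 1)`; for `h j = e (y j)` it is `δⁿ / δJ^{y₁} ⋯ δJ^{yₙ}`. -/
def iterDeriv : {n : ℕ} → (Fin n → 𝔍) → (𝔍 → ℝ) → 𝔍 → ℝ
  | 0, _, Z => Z
  | _ + 1, h, Z => fun J => lineDeriv ℝ (iterDeriv (Fin.tail h) Z) J (h 0)

/-- The components `v^{y₁⋯yₙ}`, `n ≥ 0`, are those of completely symmetric tensors, and the
expansion `∑ₙ (1/n!) v^{y₁⋯yₙ} φ_{y₁} ⋯ φ_{yₙ}` converges absolutely everywhere, also with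
`|φ_y|` replaced by `|φ_y| + |ψ_y|`.  (For finite `Λ` the addition of `ψ` changes nothing.) -/
structure IsAnalyticExpansion (B : Φ →ₗ[ℝ] 𝔍 →ₗ[ℝ] ℝ) (e : Λ → 𝔍)
    (v : (n : ℕ) → (Fin n → Λ) → ℝ) : Prop where
  symmetric : ∀ (n : ℕ) (σ : Equiv.Perm (Fin n)) (y : Fin n → Λ), v n (y ∘ σ) = v n y
  summable : ∀ φ ψ : Φ, Summable fun p : (n : ℕ) × (Fin n → Λ) =>
    (1 / (p.1.factorial : ℝ)) * |v p.1 p.2| * ∏ j, (|B φ (e (p.2 j))| + |B ψ (e (p.2 j))|)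

/-- The interaction `S_I[φ] = ∑ₙ (1/n!) v^{y₁⋯yₙ} φ_{y₁} ⋯ φ_{yₙ}`. -/
def interaction (B : Φ →ₗ[ℝ] 𝔍 →ₗ[ℝ] ℝ) (e : Λ → 𝔍)
    (v : (n : ℕ) → (Fin n → Λ) → ℝ) (φ : Φ) : ℝ :=
  ∑' n : ℕ, (1 / (n.factorial : ℝ)) * ∑' y : Fin n → Λ, v n y * ∏ j, B φ (e (y j))

/-- The total action `S[φ] = -½ ⟨φ, L φ⟩ + S_I[φ]`, for `φ` in the domain of `L`. -/
def totalAction (B : Φ →ₗ[ℝ] 𝔍 →ₗ[ℝ] ℝ) (L : Φ →ₗ.[ℝ] 𝔍) (e : Λ → 𝔍)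
    (v : (n : ℕ) → (Fin n → Λ) → ℝ) (φ : L.domain) : ℝ :=
  -(1 / 2) * B φ (L φ) + interaction B e v φ

/-- The component `v^{x y₁⋯yₙ} k_x` of the homogeneous part of degree `n` of `k_x F_I^x`, where
`p = (x, (y₁, …, yₙ))`. -/
def forceCoeff (B : Φ →ₗ[ℝ] 𝔍 →ₗ[ℝ] ℝ) (e : Λ → 𝔍) (v : (n : ℕ) → (Fin n → Λ) → ℝ)
    (k : Φ) (n : ℕ) (p : Λ × (Fin n → Λ)) : ℝ :=
  v (n + 1) (Fin.cons p.1 p.2) * B k (e p.1)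

/-- The homogeneous part of degree `n` of `k_x F_I^x[φ]` without its factor `1/n!`:
`v^{x y₁⋯yₙ} k_x φ_{y₁} ⋯ φ_{yₙ}`. -/
def forceTerm (B : Φ →ₗ[ℝ] 𝔍 →ₗ[ℝ] ℝ) (e : Λ → 𝔍) (v : (n : ℕ) → (Fin n → Λ) → ℝ)
    (k : Φ) (n : ℕ) (φ : Φ) : ℝ :=
  ∑' p : Λ × (Fin n → Λ), forceCoeff B e v k n p * ∏ j, B φ (e (p.2 j))

/-- The force of the interaction, paired with the field `k`:
`k_x F_I^x[φ] = ∑ₙ (1/n!) v^{x y₁⋯yₙ} k_x φ_{y₁} ⋯ φ_{yₙ}`. -/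
def force (B : Φ →ₗ[ℝ] 𝔍 →ₗ[ℝ] ℝ) (e : Λ → 𝔍) (v : (n : ℕ) → (Fin n → Λ) → ℝ)
    (k φ : Φ) : ℝ :=
  ∑' n : ℕ, (1 / (n.factorial : ℝ)) * forceTerm B e v k n φ

/-- The homogeneous part of degree `n`, without its factor `1/n!`, of the differential operator
`k_x F_I^x[δ/δJ]` applied to `Z` at `J`:
`v^{x y₁⋯yₙ} k_x δⁿZ[J] / δJ^{y₁} ⋯ δJ^{yₙ}`. -/
def forceOpTerm (B : Φ →ₗ[ℝ] 𝔍 →ₗ[ℝ] ℝ) (e : Λ → 𝔍) (v : (n : ℕ) → (Fin n → Λ) → ℝ)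
    (k : Φ) (n : ℕ) (Z : 𝔍 → ℝ) (J : 𝔍) : ℝ :=
  ∑' p : Λ × (Fin n → Λ), forceCoeff B e v k n p * iterDeriv (fun j => e (p.2 j)) Z J

/-- The differential operator `k_x F^x[δ/δJ]` applied to `Z` at `J`, for `k` in the domain of `L`,
where `k_x F^x[φ] = -⟨φ, L k⟩ + k_x F_I^x[φ]`: the field `φ_y` is replaced by `δ/δJ^y`. -/
def totalForceOp (B : Φ →ₗ[ℝ] 𝔍 →ₗ[ℝ] ℝ) (L : Φ →ₗ.[ℝ] 𝔍) (e : Λ → 𝔍)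
    (v : (n : ℕ) → (Fin n → Λ) → ℝ) (k : L.domain) (Z : 𝔍 → ℝ) (J : 𝔍) : ℝ :=
  -lineDeriv ℝ Z J (L k) + ∑' n : ℕ, (1 / (n.factorial : ℝ)) * forceOpTerm B e v k n Z J

/-- The expansion of `k_x F_I^x[φ] exp ⟨φ, J⟩` converges absolutely in mean, for every source `J`:
each homogeneous part as a series over its components, and then the series of homogeneous parts.
If `Z_μ` is finite, the first condition is automatic for finite `Λ`, and the second one follows
from the first when only finitely many `v n` are nonzero. -/
structure ConvergesInMean (B : Φ →ₗ[ℝ] 𝔍 →ₗ[ℝ] ℝ) (e : Λ → 𝔍)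
    (v : (n : ℕ) → (Fin n → Λ) → ℝ) [MeasurableSpace Φ] (μ : Measure Φ) (k : Φ) : Prop where
  components : ∀ (J : 𝔍) (n : ℕ), ∑' p : Λ × (Fin n → Λ),
    ∫⁻ φ, ‖forceCoeff B e v k n p * (∏ j, B φ (e (p.2 j))) * Real.exp (B φ J)‖ₑ ∂μ ≠ ⊤
  degrees : ∀ J : 𝔍, ∑' n : ℕ,
    ∫⁻ φ, ‖(1 / (n.factorial : ℝ)) * forceTerm B e v k n φ * Real.exp (B φ J)‖ₑ ∂μ ≠ ⊤

end

end FieldTheory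

/-!
The Dyson–Schwinger equations are integration by parts against the interacting state
`μ = Ξ⁻¹ exp S_I γ`, in a direction `k = G h` of the domain of `L`.

For the Gaussian state this rests on the Cameron–Martin formula
(`map_add_smul_eq_withDensity`): the translate of `γ` by `s • G h` has the density
`exp (s ⟨φ, h⟩ - ½ s² ⟨G h, h⟩)`.  Both measures have the same generating functional, and a finite
generating functional determines a measure on the cylinder sigma-algebra (`measure_ext_of_genFun`).
Differentiating `∫ f (φ + t G h) dγ` at `t = 0` in the two ways offered by this formula gives
`∫ f ⟨φ, h⟩ dγ = ∫ ∂_{G h} f dγ` (`gaussian_integral_by_parts`).  Nothing need be assumed of `f` and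
`∂_{G h} f` beyond integrability against `exp (s ⟨φ, h⟩) γ` for all `s`, since the Cameron–Martin
density also turns the integrals along the lines `φ + t G h` into integrals at `φ`.

With `f = W exp S_I`, and since `∂_k S_I = k_x F_I^x` (`hasLineDerivAt_interaction`), this becomes
`⟨φ(h) W⟩ = ⟨∂_k W⟩ + ⟨k_x F_I^x W⟩` (`integral_by_parts`).  The differential equation for `Z` is
the case `W = exp ⟨φ, J⟩`, the hierarchy for the moments the case `W = ∏ᵢ φ(Kᵢ)`.  Both weights,
and their derivatives, are bounded by finite sums of exponentials `exp ⟨φ, J⟩` (`ExpDominated`).  Hence finiteness of `Z` and condition `ConvergesInMean`, which speak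
of exponentials only, suffice for all integrability questions and for the term-by-term integration
of the force (`ConvergesInMean.hasSum_integral`).  The same domination identifies the functional
derivatives of `Z` with moments (`iterDeriv_genFun`).
-/

namespace FieldTheory

open ProbabilityTheory

variable {Φ 𝔍 Λ : Type*} [AddCommGroup Φ] [Module ℝ Φ] [AddCommGroup 𝔍] [Module ℝ 𝔍]

/-! ### Measures on the cylinder sigma-algebra -/

section Measurability

variable [mΦ : MeasurableSpace Φ] {B : Φ →ₗ[ℝ] 𝔍 →ₗ[ℝ] ℝ} (hB : mΦ = cylinderSigmaAlgebra B)
include hB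

lemma measurable_pairing (J : 𝔍) : Measurable fun φ => B φ J := by
  subst hB
  exact (comap_measurable _).mono (le_iSup (fun J : 𝔍 =>
    MeasurableSpace.comap (fun φ => B φ J) inferInstance) J) le_rfl

/-- Measurability of a map into the space of fields may be tested on the sources. -/
lemma measurable_of_pairing {α : Type*} [MeasurableSpace α] {f : α → Φ}
    (hf : ∀ J, Measurable fun a => B (f a) J) : Measurable f := by
  subst hB
  rw [measurable_iff_comap_le, MeasurableSpace.comap_iSup]
  refine iSup_le fun J => ?_
  rw [MeasurableSpace.comap_comp]
  exact (hf J).comap_le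

lemma measurable_add_smul (k : Φ) : Measurable fun p : ℝ × Φ => p.2 + p.1 • k := by
  refine measurable_of_pairing hB fun J => ?_
  have := measurable_pairing hB J
  simp only [map_add, map_smul, LinearMap.add_apply, LinearMap.smul_apply]
  exact (this.comp measurable_snd).add (measurable_fst.smul_const _)

lemma measurable_add_const_field (k : Φ) : Measurable fun φ : Φ => φ + k := by
  have := (measurable_add_smul hB k).comp (measurable_prodMk_left (x := (1 : ℝ)))
  simpa [Function.comp_def] using this

/-- A measure on the cylinder sigma-algebra with a finite generating functional is determined by
it.  On the law of a single `⟨φ, J⟩` this is the uniqueness theorem for moment generating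
functions; finitely many sources are reduced to one by the Cramér–Wold device, and the cylinder
sets of finitely many sources generate. -/
theorem measure_ext_of_genFun {ν₁ ν₂ : Measure Φ} [IsFiniteMeasure ν₁] [IsFiniteMeasure ν₂]
    (h₁ : ∀ J, Integrable (fun φ => Real.exp (B φ J)) ν₁)
    (h : ∀ J, genFun B ν₁ J = genFun B ν₂ J) : ν₁ = ν₂ := by
  have huniv : ν₁ = 0 ↔ ν₂ = 0 := by
    have h0 := h 0
    simp only [genFun, map_zero, Real.exp_zero, integral_const, smul_eq_mul, mul_one] at h0
    rw [← Measure.measure_univ_eq_zero, ← Measure.measure_univ_eq_zero,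
      ← measureReal_eq_zero_iff, ← measureReal_eq_zero_iff, h0]
  have hmeas := measurable_pairing hB
  have one (J : 𝔍) : ν₁.map (fun φ => B φ J) = ν₂.map (fun φ => B φ J) := by
    have hmgf : mgf (fun φ => B φ J) ν₁ = mgf (fun φ => B φ J) ν₂ := by
      ext t
      simpa [mgf, genFun] using h (t • J)
    refine Measure.ext_of_complexMGF_eq (hmeas J).aemeasurable (hmeas J).aemeasurable ?_
    ext z
    refine eqOn_complexMGF_of_mgf' hmgf huniv ?_
    have : integrableExpSet (fun φ => B φ J) ν₁ = Set.univ := by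
      ext t
      simpa [integrableExpSet] using h₁ (t • J)
    simp [this]
  have eval_meas : Measurable fun (φ : Φ) (J : 𝔍) => B φ J := measurable_pi_iff.2 hmeas
  have fin (s : Finset 𝔍) : (ν₁.map fun (φ : Φ) (J : 𝔍) => B φ J).map s.restrict =
      (ν₂.map fun (φ : Φ) (J : 𝔍) => B φ J).map s.restrict := by
    refine Measure.ext_of_charFunDual ?_
    ext ℓ
    classical
    have key : (fun φ : Φ => ℓ (s.restrict fun J => B φ J)) =
        fun φ => B φ (∑ J : s, ℓ (Pi.single J 1) • (J : 𝔍)) := by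
      ext φ
      rw [← ℓ.coe_coe, LinearMap.pi_apply_eq_sum_univ (ℓ : (s → ℝ) →ₗ[ℝ] ℝ), map_sum]
      refine Finset.sum_congr rfl fun J _ => ?_
      have : (fun j => if J = j then (1 : ℝ) else 0) = Pi.single J 1 := by
        ext j; simp [Pi.single_apply, eq_comm]
      simp [this, mul_comm]
    have law (ν : Measure Φ) : ((ν.map fun (φ : Φ) (J : 𝔍) => B φ J).map s.restrict).map ℓ =
        ν.map fun φ => B φ (∑ J : s, ℓ (Pi.single J 1) • (J : 𝔍)) := by
      rw [Measure.map_map (Finset.measurable_restrict s) eval_meas,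
        Measure.map_map ℓ.continuous.measurable
          ((Finset.measurable_restrict s).comp eval_meas), ← key]
      rfl
    rw [charFunDual_eq_charFun_map_one, charFunDual_eq_charFun_map_one, law, law, one]
  have hall : (ν₁.map fun (φ : Φ) (J : 𝔍) => B φ J) = ν₂.map fun (φ : Φ) (J : 𝔍) => B φ J :=
    IsProjectiveLimit.unique
      (P := fun s : Finset 𝔍 => (ν₂.map fun (φ : Φ) (J : 𝔍) => B φ J).map s.restrict)
      (fun s => fin s) (fun s => rfl)
  have hcomap : mΦ = MeasurableSpace.comap (fun (φ : Φ) (J : 𝔍) => B φ J) inferInstance := by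
    rw [hB, cylinderSigmaAlgebra, MeasurableSpace.pi, MeasurableSpace.comap_iSup]
    simp only [MeasurableSpace.comap_comp]
    rfl
  ext S hS
  rw [hcomap] at hS
  obtain ⟨T, hT, rfl⟩ := hS
  rw [← Measure.map_apply eval_meas hT, hall, Measure.map_apply eval_meas hT]

end Measurability

/-! ### Translation and integration by parts for the Gaussian state -/

section Gaussian

variable [mΦ : MeasurableSpace Φ] {B : Φ →ₗ[ℝ] 𝔍 →ₗ[ℝ] ℝ} {G : 𝔍 →ₗ[ℝ] Φ} {γ : Measure Φ}

lemma IsGaussianState.isProbabilityMeasure (hγ : IsGaussianState B G γ) :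
    IsProbabilityMeasure γ := by
  obtain ⟨hi, h⟩ := hγ 0
  simp only [map_zero, Real.exp_zero] at hi
  have : IsFiniteMeasure γ := by
    rcases integrable_const_iff.1 hi with h0 | h0
    · simp at h0
    · exact h0
  simp only [genFun, map_zero, Real.exp_zero, integral_const, smul_eq_mul, mul_one, mul_zero] at h
  exact ⟨by rwa [measureReal_def, ENNReal.toReal_eq_one_iff] at h⟩

omit mΦ in
/-- The covariance inherits the symmetry of its inverse `L`. -/
lemma inverse_symmetric {L : Φ →ₗ.[ℝ] 𝔍} (hL : IsSymmetricOperator B L)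
    (hG : IsInverseOperator L G) (J h : 𝔍) : B (G J) h = B (G h) J := by
  have := hL ⟨G J, hG.mem_domain J⟩ ⟨G h, hG.mem_domain h⟩
  rwa [hG.apply_inverse, hG.apply_inverse] at this

/-- The density, with respect to the Gaussian state, of its translate by `s • G h`. -/
noncomputable def shiftDensity (B : Φ →ₗ[ℝ] 𝔍 →ₗ[ℝ] ℝ) (G : 𝔍 →ₗ[ℝ] Φ) (h : 𝔍)
    (s : ℝ) (φ : Φ) : ℝ :=
  Real.exp (s * B φ h - s ^ 2 / 2 * B (G h) h)

omit mΦ in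
lemma shiftDensity_eq (h : 𝔍) (s : ℝ) (φ : Φ) : shiftDensity B G h s φ =
    Real.exp (-(s ^ 2 / 2 * B (G h) h)) * Real.exp (s * B φ h) := by
  rw [shiftDensity, ← Real.exp_add]; ring_nf

omit mΦ in
lemma shiftDensity_nonneg (h : 𝔍) (s : ℝ) (φ : Φ) : 0 ≤ shiftDensity B G h s φ :=
  Real.exp_nonneg _

variable (hB : mΦ = cylinderSigmaAlgebra B) (hγ : IsGaussianState B G γ)
  (hsymm : ∀ J h, B (G J) h = B (G h) J)
include hB

lemma measurable_shiftDensity (h : 𝔍) (s : ℝ) : Measurable (shiftDensity B G h s) := by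
  have := measurable_pairing hB h
  unfold shiftDensity
  fun_prop

include hγ hsymm

/-- The Cameron–Martin formula: both sides have the generating functional
`J ↦ exp (½ ⟨G J, J⟩ + s ⟨G h, J⟩)`. -/
theorem map_add_smul_eq_withDensity (h : 𝔍) (s : ℝ) :
    γ.map (fun φ => φ + s • G h) =
      γ.withDensity fun φ => ENNReal.ofReal (shiftDensity B G h s φ) := by
  have := hγ.isProbabilityMeasure
  have hmap := measurable_add_const_field hB (s • G h)
  have hdm := measurable_shiftDensity (G := G) hB h s
  have hd : Integrable (shiftDensity B G h s) γ := by
    have := ((hγ (s • h)).1.const_mul (Real.exp (-(s ^ 2 / 2 * B (G h) h))))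
    refine this.congr (ae_of_all _ fun φ => ?_)
    simp [shiftDensity_eq]
  have : IsFiniteMeasure (γ.withDensity fun φ => ENNReal.ofReal (shiftDensity B G h s φ)) :=
    isFiniteMeasure_withDensity_ofReal hd.2
  have hexp (J : 𝔍) : Measurable fun φ => Real.exp (B φ J) :=
    (measurable_pairing hB J).exp
  refine measure_ext_of_genFun hB (fun J => ?_) fun J => ?_
  · rw [integrable_map_measure (hexp J).aestronglyMeasurable hmap.aemeasurable]
    refine ((hγ J).1.mul_const (Real.exp (B (s • G h) J))).congr (ae_of_all _ fun φ => ?_)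
    simp [Real.exp_add]
  · have e1 : genFun B (γ.map fun φ => φ + s • G h) J =
        Real.exp ((1 / 2) * B (G J) J) * Real.exp (s * B (G h) J) := by
      rw [genFun, integral_map hmap.aemeasurable (hexp J).aestronglyMeasurable, ← (hγ J).2, genFun,
        ← integral_mul_const]
      simp [Real.exp_add]
    have e2 : genFun B (γ.withDensity fun φ => ENNReal.ofReal (shiftDensity B G h s φ)) J =
        Real.exp (-(s ^ 2 / 2 * B (G h) h)) *
          Real.exp ((1 / 2) * B (G (J + s • h)) (J + s • h)) := by
      rw [genFun, integral_withDensity_eq_integral_toReal_smul hdm.ennreal_ofReal (by simp),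
        ← (hγ _).2, genFun, ← integral_const_mul]
      refine integral_congr_ae (ae_of_all _ fun φ => ?_)
      simp only [smul_eq_mul, shiftDensity_eq, map_add, map_smul, Real.exp_add]
      rw [ENNReal.toReal_ofReal (by positivity)]
      ring
    rw [e1, e2, ← Real.exp_add, ← Real.exp_add]
    simp only [map_add, map_smul, LinearMap.add_apply, LinearMap.smul_apply, smul_eq_mul]
    rw [hsymm J h]
    ring_nf

lemma integral_comp_add_smul {f : Φ → ℝ} (hf : Measurable f) (h : 𝔍) (s : ℝ) :
    ∫ φ, f (φ + s • G h) ∂γ = ∫ φ, f φ * shiftDensity B G h s φ ∂γ := by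
  have hmap := measurable_add_const_field hB (s • G h)
  rw [← integral_map (φ := fun φ => φ + s • G h) hmap.aemeasurable hf.aestronglyMeasurable,
    map_add_smul_eq_withDensity hB hγ hsymm,
    integral_withDensity_eq_integral_toReal_smul
      (measurable_shiftDensity hB h s).ennreal_ofReal (by simp)]
  refine integral_congr_ae (ae_of_all _ fun φ => ?_)
  simp only [smul_eq_mul]
  rw [ENNReal.toReal_ofReal (shiftDensity_nonneg h s φ), mul_comm]

lemma integrable_comp_add_smul {f : Φ → ℝ} (hf : Measurable f) (h : 𝔍) (s : ℝ)
    (hi : Integrable (fun φ => f φ * Real.exp (s * B φ h)) γ) :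
    Integrable (fun φ => f (φ + s • G h)) γ := by
  have hmap := measurable_add_const_field hB (s • G h)
  have hm := measurable_shiftDensity (G := G) hB h s
  have : Integrable f (γ.map fun φ => φ + s • G h) := by
    rw [map_add_smul_eq_withDensity hB hγ hsymm, integrable_withDensity_iff_integrable_smul'
      hm.ennreal_ofReal (by simp)]
    refine (hi.const_mul (Real.exp (-(s ^ 2 / 2 * B (G h) h)))).congr (ae_of_all _ fun φ => ?_)
    simp only [smul_eq_mul]
    rw [ENNReal.toReal_ofReal (shiftDensity_nonneg h s φ), shiftDensity_eq]
    ring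
  exact (integrable_map_measure hf.aestronglyMeasurable hmap.aemeasurable).1 this

omit hγ hsymm in
/-- The integral of a function against the translates of the Gaussian state is differentiable in
the translation. -/
lemma hasDerivAt_integral_mul_shiftDensity {f : Φ → ℝ} (hf : Measurable f) (h : 𝔍)
    (hi : ∀ s : ℝ, Integrable (fun φ => f φ * Real.exp (s * B φ h)) γ) (s : ℝ) :
    HasDerivAt (fun s => ∫ φ, f φ * shiftDensity B G h s φ ∂γ)
      (∫ φ, f φ * (shiftDensity B G h s φ * (B φ h - s * B (G h) h)) ∂γ) s := by
  have hm := measurable_pairing hB h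
  set c := B (G h) h with hc
  have hmgf (t : ℝ) : HasDerivAt (fun s => ∫ φ, f φ * Real.exp (s * B φ h) ∂γ)
      (∫ φ, f φ * (Real.exp (t * B φ h) * B φ h) ∂γ) t ∧
      Integrable (fun φ => f φ * (Real.exp (t * B φ h) * B φ h)) γ := by
    have := hasDerivAt_integral_of_dominated_loc_of_deriv_le (μ := γ) (x₀ := t)
      (F := fun s φ => f φ * Real.exp (s * B φ h))
      (F' := fun s φ => f φ * (Real.exp (s * B φ h) * B φ h))
      (bound := fun φ => |f φ * Real.exp ((t + 2) * B φ h)| + |f φ * Real.exp ((t - 2) * B φ h)|)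
      (Metric.ball_mem_nhds t one_pos) (.of_forall fun s => (hi s).1) (hi t)
      (by fun_prop) (ae_of_all _ fun φ s hs => ?_) ((hi _).abs.add (hi _).abs)
      (ae_of_all _ fun φ s hs => ?_)
    · exact ⟨this.2, this.1⟩
    · rw [Metric.mem_ball, Real.dist_eq, abs_lt] at hs
      simp only [Real.norm_eq_abs, abs_mul, Real.abs_exp, ← mul_add]
      refine mul_le_mul_of_nonneg_left ?_ (abs_nonneg _)
      -- `|x| ≤ exp |x|` absorbs the factor `⟨φ, h⟩` at the cost of one unit in the exponent.
      have hx : |B φ h| ≤ Real.exp |B φ h| := by linarith [Real.add_one_le_exp |B φ h|]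
      calc Real.exp (s * B φ h) * |B φ h| ≤ Real.exp (s * B φ h) * Real.exp |B φ h| := by gcongr
        _ = Real.exp (s * B φ h + |B φ h|) := (Real.exp_add _ _).symm
        _ ≤ _ := by
          rcases le_total 0 (B φ h) with h0 | h0
          · refine le_add_of_le_of_nonneg (Real.exp_le_exp.2 ?_) (Real.exp_nonneg _)
            rw [abs_of_nonneg h0]; nlinarith
          · refine le_add_of_nonneg_of_le (Real.exp_nonneg _) (Real.exp_le_exp.2 ?_)
            rw [abs_of_nonpos h0]; nlinarith
    · have := (((hasDerivAt_id s).mul_const (B φ h)).exp).const_mul (f φ)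
      simpa using this
  have h1 : HasDerivAt (fun s : ℝ => Real.exp (-(s ^ 2 / 2 * c)))
      (Real.exp (-(s ^ 2 / 2 * c)) * (-(s * c))) s := by
    have := ((((hasDerivAt_id s).pow 2).div_const 2).mul_const c).neg.exp
    simpa using this
  have h2 := h1.mul (hmgf s).1
  have e1 : (fun s => ∫ φ, f φ * shiftDensity B G h s φ ∂γ) =
      fun s => Real.exp (-(s ^ 2 / 2 * c)) * ∫ φ, f φ * Real.exp (s * B φ h) ∂γ := by
    ext s
    rw [← integral_const_mul]
    refine integral_congr_ae (ae_of_all _ fun φ => ?_)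
    simp only [shiftDensity_eq, ← hc]; ring
  have e2 : ∫ φ, f φ * (shiftDensity B G h s φ * (B φ h - s * c)) ∂γ =
      Real.exp (-(s ^ 2 / 2 * c)) * (-(s * c)) * (∫ φ, f φ * Real.exp (s * B φ h) ∂γ) +
        Real.exp (-(s ^ 2 / 2 * c)) * ∫ φ, f φ * (Real.exp (s * B φ h) * B φ h) ∂γ := by
    rw [← integral_const_mul, ← integral_const_mul, ← integral_add ((hi s).const_mul _)
      ((hmgf s).2.const_mul _)]
    refine integral_congr_ae (ae_of_all _ fun φ => ?_)
    simp only [shiftDensity_eq, ← hc]; ring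
  rw [e1, e2]
  exact h2

/-- Integration by parts for the Gaussian state.  By the fundamental theorem of calculus and
Fubini, `∫ f (φ + t G h) dγ - ∫ f dγ = ∫₀ᵗ ∫ f' (φ + s G h) dγ ds`; by the Cameron–Martin formula
both sides are differentiable at `t = 0`, with derivatives `∫ f ⟨φ, h⟩ dγ` and `∫ f' dγ`. -/
theorem gaussian_integral_by_parts {f f' : Φ → ℝ} (hf : Measurable f) (hf' : Measurable f')
    (h : 𝔍) (hderiv : ∀ φ, HasLineDerivAt ℝ f (f' φ) φ (G h))
    (hi : ∀ s : ℝ, Integrable (fun φ => f φ * Real.exp (s * B φ h)) γ)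
    (hi' : ∀ s : ℝ, Integrable (fun φ => f' φ * Real.exp (s * B φ h)) γ) :
    ∫ φ, f φ * B φ h ∂γ = ∫ φ, f' φ ∂γ := by
  have := hγ.isProbabilityMeasure
  set k := G h with hk
  have hjoint : Measurable (Function.uncurry fun (s : ℝ) φ => f' (φ + s • k)) :=
    hf'.comp (measurable_add_smul hB k)
  have hcont {g : Φ → ℝ} (hg : Measurable g)
      (hgi : ∀ s : ℝ, Integrable (fun φ => g φ * Real.exp (s * B φ h)) γ) :
      Continuous fun s : ℝ => ∫ φ, g (φ + s • k) ∂γ := by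
    simp only [hk, integral_comp_add_smul hB hγ hsymm hg h]
    exact continuous_iff_continuousAt.2 fun s =>
      (hasDerivAt_integral_mul_shiftDensity hB hg h hgi s).continuousAt
  have habs (s : ℝ) : Integrable (fun φ => |f' φ| * Real.exp (s * B φ h)) γ :=
    (hi' s).abs.congr (ae_of_all _ fun φ => by simp [abs_mul])
  have hprod (t : ℝ) : Integrable (Function.uncurry fun (s : ℝ) φ => f' (φ + s • k))
      ((volume.restrict (Set.uIoc 0 t)).prod γ) := by
    rw [integrable_prod_iff hjoint.aestronglyMeasurable]
    refine ⟨ae_of_all _ fun s => integrable_comp_add_smul hB hγ hsymm hf' h s (hi' s), ?_⟩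
    have : Continuous fun s : ℝ => ∫ φ, |f' (φ + s • k)| ∂γ := hcont hf'.abs habs
    exact intervalIntegrable_iff.1 (this.intervalIntegrable 0 t)
  have hftc (t : ℝ) : (∫ φ, f (φ + t • k) ∂γ) - ∫ φ, f φ ∂γ =
      ∫ s in (0 : ℝ)..t, ∫ φ, f' (φ + s • k) ∂γ := by
    rw [intervalIntegral_integral_swap (hprod t), ← integral_sub
      (integrable_comp_add_smul hB hγ hsymm hf h t (hi t)) (by simpa using hi 0)]
    refine integral_congr_ae ?_
    -- The derivative along the line through `φ` is integrable for almost every `φ`, by Fubini.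
    filter_upwards [(integrable_prod_iff' hjoint.aestronglyMeasurable).1 (hprod t) |>.1] with φ hφ
    simp only [Function.uncurry_apply_pair] at hφ
    rw [intervalIntegral.integral_eq_sub_of_hasDerivAt (f := fun s => f (φ + s • k))
      (fun s _ => ?_) (intervalIntegrable_iff.2 hφ)]
    · simp [hk]
    · have h0 : HasDerivAt (fun t => f (φ + s • k + t • k)) (f' (φ + s • k)) (s - s) := by
        simpa [HasLineDerivAt] using hderiv (φ + s • k)
      have h1 := h0.comp (h := fun t => t - s) s ((hasDerivAt_id s).sub_const s)
      have e : (fun s => f (φ + s • k)) = (fun t => f (φ + s • k + t • k)) ∘ fun t => t - s := by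
        ext t
        simp only [Function.comp]
        rw [add_assoc, ← add_smul, add_sub_cancel]
      rw [e]
      simpa only [mul_one] using h1
  have hA := hasDerivAt_integral_mul_shiftDensity (G := G) hB hf h hi 0
  have hR : HasDerivAt (fun t => ∫ s in (0 : ℝ)..t, ∫ φ, f' (φ + s • k) ∂γ)
      (∫ φ, f' (φ + (0 : ℝ) • k) ∂γ) 0 :=
    intervalIntegral.integral_hasDerivAt_right (by simp)
      (hcont hf' hi').stronglyMeasurable.stronglyMeasurableAtFilter (hcont hf' hi').continuousAt
  simp only [← hftc] at hR
  simp only [hk, integral_comp_add_smul hB hγ hsymm hf h] at hR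
  have := hR.unique (hA.sub_const _)
  simpa [shiftDensity, mul_comm] using this.symm

end Gaussian

/-! ### The force as the gradient of the action -/

section Force

/-- The terms of first order in `b` in the expansion of `∏ (a + b)` are bounded by the whole
product.  This turns the convergence assumed of the interaction into convergence of the
differentiated series. -/
lemma sum_mul_prod_erase_le {ι : Type*} [Fintype ι] [DecidableEq ι] {a b : ι → ℝ}
    (ha : ∀ i, 0 ≤ a i) (hb : ∀ i, 0 ≤ b i) :
    ∑ j, (∏ i ∈ Finset.univ.erase j, a i) * b j ≤ ∏ i, (a i + b i) := by
  have h : ∏ i, (a i + b i) = ∏ i, (b i + a i) := by simp only [add_comm]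
  rw [h, Finset.prod_add]
  calc ∑ j, (∏ i ∈ Finset.univ.erase j, a i) * b j
      = ∑ t ∈ Finset.univ.map ⟨fun j : ι => ({j} : Finset ι), Finset.singleton_injective⟩,
          (∏ i ∈ t, b i) * ∏ i ∈ Finset.univ \ t, a i := by
        simp [Finset.sdiff_singleton_eq_erase, mul_comm]
    _ ≤ _ := Finset.sum_le_sum_of_subset_of_nonneg (fun t _ => by simp) fun t _ _ =>
        mul_nonneg (Finset.prod_nonneg fun i _ => hb i) (Finset.prod_nonneg fun i _ => ha i)

variable {B : Φ →ₗ[ℝ] 𝔍 →ₗ[ℝ] ℝ} {e : Λ → 𝔍} {v : (n : ℕ) → (Fin n → Λ) → ℝ}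
  (hv : IsAnalyticExpansion B e v)
include hv

lemma summable_interaction (φ : Φ) : Summable fun p : (n : ℕ) × (Fin n → Λ) =>
    (1 / (p.1.factorial : ℝ)) * (v p.1 p.2 * ∏ j, B φ (e (p.2 j))) := by
  refine .of_norm_bounded (hv.summable φ 0) fun p => le_of_eq ?_
  simp [mul_assoc]

lemma interaction_eq_tsum_sigma (φ : Φ) : interaction B e v φ =
    ∑' p : (n : ℕ) × (Fin n → Λ),
      (1 / (p.1.factorial : ℝ)) * (v p.1 p.2 * ∏ j, B φ (e (p.2 j))) := by
  rw [(summable_interaction hv φ).tsum_sigma]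
  simp only [interaction, tsum_mul_left]

/-- By symmetry of `v`, the index contracted with `k` may be moved to any position `j`. -/
lemma forceCoeff_mul_prod (φ k : Φ) {n : ℕ} (j : Fin (n + 1)) (p : Λ × (Fin n → Λ)) :
    forceCoeff B e v k n p * ∏ i, B φ (e (p.2 i)) =
      v (n + 1) (j.insertNth p.1 p.2) *
        ((∏ i ∈ Finset.univ.erase j, B φ (e ((j.insertNth p.1 p.2 : Fin (n + 1) → Λ) i))) *
          B k (e ((j.insertNth p.1 p.2 : Fin (n + 1) → Λ) j))) := by
  have hprod : ∏ i ∈ Finset.univ.erase j, B φ (e ((j.insertNth p.1 p.2 : Fin (n + 1) → Λ) i)) =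
      ∏ i, B φ (e (p.2 i)) := by
    have : Finset.univ.erase j = Finset.univ.map j.succAboveEmb := by
      ext i
      simp
    simp [this]
  rw [hprod, ← Fin.cons_comp_cycleRange, hv.symmetric, Fin.cons_comp_cycleRange,
    Fin.insertNth_apply_same, forceCoeff]
  ring

lemma summable_forceCoeff (φ k : Φ) (n : ℕ) :
    Summable fun p : Λ × (Fin n → Λ) => forceCoeff B e v k n p * ∏ i, B φ (e (p.2 i)) := by
  have h := ((hv.summable φ k).sigma_factor (n + 1)).mul_left ((n + 1).factorial : ℝ)
  have h' := (Fin.insertNthEquiv (fun _ : Fin (n + 1) => Λ) 0).summable_iff.2 h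
  refine .of_norm_bounded h' fun p => ?_
  have hF : ((n + 1).factorial : ℝ) ≠ 0 := by positivity
  rw [forceCoeff_mul_prod hv φ k 0 p]
  simp only [Function.comp, Fin.insertNthEquiv_apply, Real.norm_eq_abs, abs_mul, Finset.abs_prod]
  rw [mul_assoc (1 / _ : ℝ), ← mul_assoc ((n + 1).factorial : ℝ), mul_one_div_cancel hF, one_mul]
  refine mul_le_mul_of_nonneg_left ?_ (abs_nonneg _)
  refine le_trans ?_ (sum_mul_prod_erase_le (fun i => abs_nonneg _) fun i => abs_nonneg _)
  exact Finset.single_le_sum (f := fun j : Fin (n + 1) =>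
    (∏ i ∈ Finset.univ.erase j, |B φ (e ((Fin.insertNth 0 p.1 p.2 : Fin (n + 1) → Λ) i))|) *
      |B k (e ((Fin.insertNth 0 p.1 p.2 : Fin (n + 1) → Λ) j))|) (fun i _ => by positivity) (Finset.mem_univ (0 : Fin (n + 1)))

/-- The coefficient of `t` in the expansion of `φ_y + t k_y` in the homogeneous part of degree
`n + 1`: by symmetry of `v` the `n + 1` factors contribute equally. -/
lemma tsum_derivative_eq_forceTerm (φ k : Φ) (n : ℕ) :
    ∑' y : Fin (n + 1) → Λ, (1 / ((n + 1).factorial : ℝ)) * (v (n + 1) y *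
      ∑ j, (∏ i ∈ Finset.univ.erase j, B φ (e (y i))) * B k (e (y j))) =
      (1 / (n.factorial : ℝ)) * forceTerm B e v k n φ := by
  have hsum (j : Fin (n + 1)) : HasSum (fun y : Fin (n + 1) → Λ => v (n + 1) y *
      ((∏ i ∈ Finset.univ.erase j, B φ (e (y i))) * B k (e (y j)))) (forceTerm B e v k n φ) := by
    rw [← (Fin.insertNthEquiv (fun _ : Fin (n + 1) => Λ) j).hasSum_iff]
    simpa only [forceTerm, forceCoeff_mul_prod hv φ k j] using!
      (summable_forceCoeff hv φ k n).hasSum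
  simp only [tsum_mul_left]
  simp only [Finset.mul_sum]
  rw [(hasSum_sum fun j _ => hsum j).tsum_eq]
  simp only [Finset.sum_const, Finset.card_univ, Fintype.card_fin, nsmul_eq_mul, ← mul_assoc]
  congr 1
  push_cast [Nat.factorial_succ]
  field_simp

/-- The force is the gradient of the interaction: for `|t| < 1` the expansion at `φ + t k` may be
differentiated term by term, being dominated by the expansion at `|φ| + 2 |k|`. -/
theorem hasLineDerivAt_interaction (φ k : Φ) :
    HasLineDerivAt ℝ (interaction B e v) (force B e v k φ) φ k := by
  set u : ((n : ℕ) × (Fin n → Λ)) → ℝ := fun p =>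
    (1 / (p.1.factorial : ℝ)) * |v p.1 p.2| *
      ∏ j, (|B φ (e (p.2 j))| + |B ((2 : ℝ) • k) (e (p.2 j))|) with hu
  set D : ((n : ℕ) × (Fin n → Λ)) → ℝ → ℝ := fun p t =>
    (1 / (p.1.factorial : ℝ)) * (v p.1 p.2 *
      ∑ j, (∏ i ∈ Finset.univ.erase j, B (φ + t • k) (e (p.2 i))) * B k (e (p.2 j))) with hD
  have hbound (p : (n : ℕ) × (Fin n → Λ)) (t : ℝ) (ht : t ∈ Metric.ball (0 : ℝ) 1) :
      ‖D p t‖ ≤ u p := by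
    have ht : |t| ≤ 1 := by simpa using (Metric.mem_ball.1 ht).le
    simp only [hD, hu, Real.norm_eq_abs, abs_mul, mul_assoc]
    rw [abs_of_nonneg (by positivity : (0 : ℝ) ≤ 1 / (p.1.factorial : ℝ))]
    refine mul_le_mul_of_nonneg_left (mul_le_mul_of_nonneg_left ?_ (abs_nonneg _)) (by positivity)
    calc |∑ j, (∏ i ∈ Finset.univ.erase j, B (φ + t • k) (e (p.2 i))) * B k (e (p.2 j))|
        ≤ ∑ j, (∏ i ∈ Finset.univ.erase j, (|B φ (e (p.2 i))| + |B k (e (p.2 i))|)) *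
            |B k (e (p.2 j))| := by
          refine (Finset.abs_sum_le_sum_abs _ _).trans (Finset.sum_le_sum fun j _ => ?_)
          rw [abs_mul, Finset.abs_prod]
          refine mul_le_mul_of_nonneg_right (Finset.prod_le_prod (fun i _ => abs_nonneg _)
            fun i _ => ?_) (abs_nonneg _)
          simp only [map_add, map_smul, LinearMap.add_apply, LinearMap.smul_apply, smul_eq_mul]
          refine (abs_add_le _ _).trans (add_le_add_right ?_ _)
          rw [abs_mul]
          exact mul_le_of_le_one_left (abs_nonneg _) ht
      _ ≤ ∏ i, (|B φ (e (p.2 i))| + |B k (e (p.2 i))| + |B k (e (p.2 i))|) :=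
          sum_mul_prod_erase_le (fun i => by positivity) fun i => abs_nonneg _
      _ = _ := by
          refine Finset.prod_congr rfl fun i _ => ?_
          simp only [map_smul, LinearMap.smul_apply, smul_eq_mul, abs_mul, abs_two]
          ring
  have h0 : (0 : ℝ) ∈ Metric.ball (0 : ℝ) 1 := Metric.mem_ball_self one_pos
  have hderiv := hasDerivAt_tsum_of_isPreconnected (hv.summable φ ((2 : ℝ) • k))
    Metric.isOpen_ball (convex_ball (0 : ℝ) 1).isPreconnected
    (g := fun p t => (1 / (p.1.factorial : ℝ)) * (v p.1 p.2 * ∏ j, B (φ + t • k) (e (p.2 j))))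
    (g' := D) (fun p t _ => ?_) hbound h0 (by simpa using summable_interaction hv φ) h0
  · simp only [← interaction_eq_tsum_sigma hv] at hderiv
    rw [HasLineDerivAt]
    convert hderiv using 1
    have hs : Summable fun p => D p 0 := .of_norm_bounded (hv.summable φ ((2 : ℝ) • k))
      fun p => hbound p 0 h0
    -- The constant term of the interaction does not contribute to the derivative.
    rw [hs.tsum_sigma, hs.sigma.tsum_eq_zero_add]
    simp only [hD, zero_smul, add_zero, tsum_derivative_eq_forceTerm hv]
    simp [force]
  · refine HasDerivAt.const_mul _ (HasDerivAt.const_mul _ ?_)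
    refine HasDerivAt.fun_finsetProd (u := Finset.univ) (f := fun j t => B (φ + t • k) (e (p.2 j)))
      (f' := fun j => B k (e (p.2 j))) fun j _ => ?_
    have := ((hasDerivAt_id t).mul_const (B k (e (p.2 j)))).const_add (B φ (e (p.2 j)))
    simpa using this

omit hv in
lemma measurable_interaction [mΦ : MeasurableSpace Φ] [Countable Λ]
    (hB : mΦ = cylinderSigmaAlgebra B) : Measurable (interaction B e v) := by
  have := measurable_pairing hB
  unfold interaction
  fun_prop

omit hv in
lemma measurable_forceTerm [mΦ : MeasurableSpace Φ] [Countable Λ]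
    (hB : mΦ = cylinderSigmaAlgebra B) (k : Φ) (n : ℕ) : Measurable (forceTerm B e v k n) := by
  have := measurable_pairing hB
  unfold forceTerm
  fun_prop

omit hv in
lemma measurable_force [mΦ : MeasurableSpace Φ] [Countable Λ]
    (hB : mΦ = cylinderSigmaAlgebra B) (k : Φ) : Measurable (force B e v k) := by
  have := measurable_forceTerm (e := e) (v := v) hB k
  unfold force
  fun_prop

/-- By symmetry of `L`, the quadratic part `-½ ⟨φ, L φ⟩` of the action has the derivative
`-⟨φ, L k⟩` in the direction `k`. -/
theorem hasLineDerivAt_totalAction {L : Φ →ₗ.[ℝ] 𝔍} (hL : IsSymmetricOperator B L)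
    (φ k : L.domain) : HasLineDerivAt ℝ (totalAction B L e v)
      (-B φ (L k) + force B e v k φ) φ k := by
  have h := hasLineDerivAt_interaction hv (φ : Φ) k
  unfold HasLineDerivAt at h ⊢
  have hq : HasDerivAt (fun t : ℝ => -(1 / 2) * (B φ (L φ) + t * (2 * B φ (L k)) +
      t ^ 2 * B k (L k))) (-B φ (L k)) 0 := by
    have := ((((hasDerivAt_id (0 : ℝ)).mul_const (2 * B φ (L k))).const_add (B φ (L φ))).add
      (((hasDerivAt_id (0 : ℝ)).pow 2).mul_const (B k (L k)))).const_mul (-(1 / 2) : ℝ)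
    exact HasDerivAt.congr_deriv this (by simp)
  convert hq.add h using 1
  ext t
  simp only [totalAction, Pi.add_apply, Submodule.coe_add, Submodule.coe_smul, LinearPMap.map_add,
    LinearPMap.map_smul, map_add, map_smul, LinearMap.add_apply, LinearMap.smul_apply, smul_eq_mul]
  rw [hL k φ]
  ring

end Force

/-! ### Exponentially dominated functions and convergence in mean -/

/-- A function of the field is exponentially dominated if it is bounded by a finite sum of
exponentials `exp ⟨φ, J⟩`.  These functions form an algebra that contains the polynomials in the
field as well as the exponentials, and they are integrable against every measure whose generating
functional is finite. -/
def ExpDominated (B : Φ →ₗ[ℝ] 𝔍 →ₗ[ℝ] ℝ) (W : Φ → ℝ) : Prop :=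
  ∃ (ι : Type) (_ : Fintype ι) (J : ι → 𝔍), ∀ φ, |W φ| ≤ ∑ i, Real.exp (B φ (J i))

namespace ExpDominated

variable {B : Φ →ₗ[ℝ] 𝔍 →ₗ[ℝ] ℝ} {W W' : Φ → ℝ}

lemma mono (hW : ExpDominated B W) (h : ∀ φ, |W' φ| ≤ |W φ|) : ExpDominated B W' := by
  obtain ⟨ι, _, J, hJ⟩ := hW
  exact ⟨ι, inferInstance, J, fun φ => (h φ).trans (hJ φ)⟩

lemma abs (hW : ExpDominated B W) : ExpDominated B fun φ => |W φ| :=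
  hW.mono fun _ => (abs_abs _).le

lemma exp (J : 𝔍) : ExpDominated B fun φ => Real.exp (B φ J) :=
  ⟨Unit, inferInstance, fun _ => J, fun φ => by simp⟩

lemma const (c : ℝ) : ExpDominated B fun _ => c := by
  obtain ⟨N, hN⟩ := exists_nat_ge |c|
  exact ⟨Fin N, inferInstance, fun _ => 0, fun φ => by simpa using hN⟩

lemma add (hW : ExpDominated B W) (hW' : ExpDominated B W') :
    ExpDominated B fun φ => W φ + W' φ := by
  obtain ⟨ι, _, J, hJ⟩ := hW
  obtain ⟨ι', _, J', hJ'⟩ := hW'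
  refine ⟨ι ⊕ ι', inferInstance, Sum.elim J J', fun φ => ?_⟩
  rw [Fintype.sum_sum_type]
  exact (abs_add_le _ _).trans (add_le_add (hJ φ) (hJ' φ))

lemma mul (hW : ExpDominated B W) (hW' : ExpDominated B W') :
    ExpDominated B fun φ => W φ * W' φ := by
  obtain ⟨ι, _, J, hJ⟩ := hW
  obtain ⟨ι', _, J', hJ'⟩ := hW'
  refine ⟨ι × ι', inferInstance, fun p => J p.1 + J' p.2, fun φ => ?_⟩
  simp only [map_add, Real.exp_add]
  rw [abs_mul, Fintype.sum_prod_type' (f := fun i i' => Real.exp (B φ (J i)) *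
    Real.exp (B φ (J' i'))), ← Finset.sum_mul_sum]
  exact mul_le_mul (hJ φ) (hJ' φ) (abs_nonneg _) ((abs_nonneg _).trans (hJ φ))

lemma pairing (K : 𝔍) : ExpDominated B fun φ => B φ K := by
  refine ((exp K).add (exp (-K))).mono fun φ => ?_
  rw [abs_of_pos (by positivity : (0 : ℝ) < Real.exp (B φ K) + Real.exp (B φ (-K))), map_neg]
  have h₁ := Real.add_one_le_exp (B φ K)
  have h₂ := Real.add_one_le_exp (-B φ K)
  have h₃ := Real.exp_pos (B φ K)
  have h₄ := Real.exp_pos (-B φ K)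
  exact abs_le.2 ⟨by linarith, by linarith⟩

lemma sum {ι : Type*} (s : Finset ι) {W : ι → Φ → ℝ} (hW : ∀ i, ExpDominated B (W i)) :
    ExpDominated B fun φ => ∑ i ∈ s, W i φ := by
  classical
  induction s using Finset.induction_on with
  | empty => simpa using const 0
  | insert i s hi ih => simpa only [Finset.sum_insert hi] using (hW i).add ih

lemma prod {ι : Type*} (s : Finset ι) {W : ι → Φ → ℝ} (hW : ∀ i, ExpDominated B (W i)) :
    ExpDominated B fun φ => ∏ i ∈ s, W i φ := by
  classical
  induction s using Finset.induction_on with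
  | empty => simpa using const 1
  | insert i s hi ih => simpa only [Finset.prod_insert hi] using (hW i).mul ih

lemma integrable [MeasurableSpace Φ] {ν : Measure Φ}
    (hν : ∀ J, Integrable (fun φ => Real.exp (B φ J)) ν) (hW : ExpDominated B W)
    (hm : Measurable W) : Integrable W ν := by
  obtain ⟨ι, _, J, hJ⟩ := hW
  exact (integrable_finsetSum Finset.univ fun i _ => hν (J i)).mono' hm.aestronglyMeasurable
    (ae_of_all _ hJ)

/-- Convergence in mean against all exponentials implies convergence in mean against every
exponentially dominated function. -/
lemma tsum_lintegral_ne_top [MeasurableSpace Φ] {ν : Measure Φ} {κ : Type*} {f : κ → Φ → ℝ}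
    (hexp : ∀ J, Measurable fun φ => Real.exp (B φ J)) (hf : ∀ i, Measurable (f i))
    (h : ∀ J, ∑' i, ∫⁻ φ, ‖f i φ * Real.exp (B φ J)‖ₑ ∂ν ≠ ⊤) (hW : ExpDominated B W) :
    ∑' i, ∫⁻ φ, ‖f i φ * W φ‖ₑ ∂ν ≠ ⊤ := by
  obtain ⟨ι, _, J, hJ⟩ := hW
  have hle (i : κ) : ∫⁻ φ, ‖f i φ * W φ‖ₑ ∂ν ≤
      ∑ j, ∫⁻ φ, ‖f i φ * Real.exp (B φ (J j))‖ₑ ∂ν := by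
    rw [← lintegral_finsetSum _ fun j _ => ((hf i).fun_mul (hexp _)).enorm]
    refine lintegral_mono fun φ => ?_
    have : ‖f i φ * W φ‖ ≤ ‖∑ j, f i φ * Real.exp (B φ (J j))‖ := by
      rw [← Finset.mul_sum, norm_mul, norm_mul]
      refine mul_le_mul_of_nonneg_left ((hJ φ).trans (le_abs_self _)) (norm_nonneg _)
    exact (enorm_le_iff_norm_le.2 this).trans (enorm_sum_le _ _)
  refine ne_top_of_le_ne_top ?_ (ENNReal.tsum_le_tsum hle)
  rw [Summable.tsum_finsetSum fun j _ => ENNReal.summable]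
  exact ENNReal.sum_ne_top.2 fun j _ => h (J j)

end ExpDominated

/-- A series that converges absolutely in mean may be integrated term by term. -/
lemma hasSum_integral_of_tsum_lintegral_ne_top {α κ : Type*} [MeasurableSpace α] [Countable κ]
    {ν : Measure α} {F : κ → α → ℝ} (hF : ∀ i, Measurable (F i))
    (h : ∑' i, ∫⁻ a, ‖F i a‖ₑ ∂ν ≠ ⊤) :
    Integrable (fun a => ∑' i, F i a) ν ∧
      HasSum (fun i => ∫ a, F i a ∂ν) (∫ a, ∑' i, F i a ∂ν) := by
  have hi (i : κ) : Integrable (F i) ν :=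
    ⟨(hF i).aestronglyMeasurable, (ENNReal.ne_top_of_tsum_ne_top h i).lt_top⟩
  refine ⟨⟨(Measurable.tsum hF).aestronglyMeasurable, ?_⟩, ?_⟩
  · refine lt_of_le_of_lt (lintegral_mono fun a => enorm_tsum_le_tsum_enorm) ?_
    rw [lintegral_tsum fun i => (hF i).enorm.aemeasurable]
    exact h.lt_top
  · refine hasSum_integral_of_summable_integral_norm hi ?_
    simp only [integral_norm_eq_lintegral_enorm (hF _).aestronglyMeasurable]
    exact ENNReal.summable_toReal h

/-! ### Functional derivatives of the generating functional -/

section GeneratingFunctional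

variable [mΦ : MeasurableSpace Φ] {B : Φ →ₗ[ℝ] 𝔍 →ₗ[ℝ] ℝ} {μ : Measure Φ}
  (hB : mΦ = cylinderSigmaAlgebra B) (hZ : ∀ J, Integrable (fun φ => Real.exp (B φ J)) μ)
include hB hZ

/-- Differentiation with respect to the source under the integral sign multiplies the weight by
the field. -/
lemma hasLineDerivAt_integral_mul_exp {W : Φ → ℝ} (hW : ExpDominated B W) (hm : Measurable W)
    (J h : 𝔍) : HasLineDerivAt ℝ (fun J => ∫ φ, W φ * Real.exp (B φ J) ∂μ)
      (∫ φ, B φ h * W φ * Real.exp (B φ J) ∂μ) J h := by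
  have hpair := measurable_pairing hB
  have key := hasDerivAt_integral_of_dominated_loc_of_deriv_le (μ := μ) (x₀ := (0 : ℝ))
    (F := fun t φ => W φ * Real.exp (B φ (J + t • h)))
    (F' := fun t φ => B φ h * W φ * Real.exp (B φ (J + t • h)))
    (bound := fun φ => |B φ h * W φ| * (Real.exp (B φ (J + h)) + Real.exp (B φ (J - h))))
    (Metric.ball_mem_nhds 0 one_pos)
    (.of_forall fun t => (hm.mul (hpair _).exp).aestronglyMeasurable)
    ((hW.mul (.exp _)).integrable hZ (hm.mul (hpair _).exp))
    (((hpair h).mul hm).mul (hpair _).exp).aestronglyMeasurable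
    (ae_of_all _ fun φ t ht => ?_)
    ((((ExpDominated.pairing h).mul hW).abs.mul ((ExpDominated.exp _).add (.exp _))).integrable hZ
      (((hpair h).mul hm).abs.mul ((hpair _).exp.add (hpair _).exp)))
    (ae_of_all _ fun φ t ht => ?_)
  · have := key.2
    simp only [zero_smul, add_zero] at this
    exact this
  · -- `exp ⟨φ, t h⟩` is at most its value at `t = 1` or at `t = -1`, according to the sign.
    have ht := abs_lt.1 (by simpa using ht : |t| < 1)
    rw [norm_mul, Real.norm_eq_abs, Real.norm_eq_abs, Real.abs_exp]
    refine mul_le_mul_of_nonneg_left ?_ (abs_nonneg _)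
    simp only [map_add, map_sub, map_smul, smul_eq_mul]
    rcases le_total 0 (B φ h) with h0 | h0
    · exact le_add_of_le_of_nonneg (Real.exp_le_exp.2 (by nlinarith)) (Real.exp_nonneg _)
    · exact le_add_of_nonneg_of_le (Real.exp_nonneg _) (Real.exp_le_exp.2 (by nlinarith))
  · have := (((((hasDerivAt_id t).mul_const (B φ h)).const_add (B φ J))).exp).const_mul (W φ)
    simp only [map_add, map_smul, smul_eq_mul]
    refine this.congr_deriv ?_
    simp only [id]
    ring

omit hZ in
lemma measurable_prod_pairing {ι : Type*} (s : Finset ι) (K : ι → 𝔍) :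
    Measurable fun φ => ∏ i ∈ s, B φ (K i) :=
  Finset.measurable_fun_prod _ fun i _ => measurable_pairing hB (K i)

/-- The functional derivatives of `Z` are the moments of `exp ⟨φ, J⟩ μ`. -/
theorem iterDeriv_genFun {n : ℕ} (h : Fin n → 𝔍) : iterDeriv h (genFun B μ) =
    fun J => ∫ φ, (∏ j, B φ (h j)) * Real.exp (B φ J) ∂μ := by
  induction n with
  | zero => ext J; simp [iterDeriv, genFun]
  | succ n ih =>
    ext J
    rw [iterDeriv, ih (Fin.tail h)]
    have := hasLineDerivAt_integral_mul_exp hB hZ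
      (.prod Finset.univ fun j => ExpDominated.pairing (Fin.tail h j))
      (measurable_prod_pairing hB Finset.univ (Fin.tail h)) J (h 0)
    refine this.lineDeriv.trans ?_
    simp only [Fin.prod_univ_succ]
    rfl

theorem lineDifferentiableAt_iterDeriv_genFun {n : ℕ} (h : Fin n → 𝔍) (J h' : 𝔍) :
    LineDifferentiableAt ℝ (iterDeriv h (genFun B μ)) J h' := by
  rw [iterDeriv_genFun hB hZ]
  exact (hasLineDerivAt_integral_mul_exp hB hZ
      (.prod Finset.univ fun j => ExpDominated.pairing (h j))
      (measurable_prod_pairing hB Finset.univ h) J h').lineDifferentiableAt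

/-- For finite `Λ` and a polynomial interaction, the sums in the convergence condition are finite
and their terms are moments of exponentially weighted fields. -/
theorem convergesInMean_of_finite [Finite Λ] {e : Λ → 𝔍} {v : (n : ℕ) → (Fin n → Λ) → ℝ}
    {N : ℕ} (hN : ∀ n, N ≤ n → ∀ y, v n y = 0) (k : Φ) : ConvergesInMean B e v μ k := by
  have := Fintype.ofFinite Λ
  have hpair := measurable_pairing hB
  have hdom (n : ℕ) (p : Λ × (Fin n → Λ)) :
      ExpDominated B fun φ => forceCoeff B e v k n p * ∏ j, B φ (e (p.2 j)) :=
    (ExpDominated.const _).mul (.prod _ fun j => .pairing _)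
  have hmeas (n : ℕ) (p : Λ × (Fin n → Λ)) :
      Measurable fun φ => forceCoeff B e v k n p * ∏ j, B φ (e (p.2 j)) :=
    (measurable_prod_pairing hB _ _).const_mul _
  constructor
  · intro J n
    rw [tsum_fintype]
    exact ENNReal.sum_ne_top.2 fun p _ =>
      (((hdom n p).mul (.exp J)).integrable hZ ((hmeas n p).mul (hpair J).exp)).2.ne
  · intro J
    rw [tsum_eq_sum (s := Finset.range N)]
    · refine ENNReal.sum_ne_top.2 fun n _ => ?_
      have hterm : forceTerm B e v k n =
          fun φ => ∑ p, forceCoeff B e v k n p * ∏ j, B φ (e (p.2 j)) := by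
        ext φ
        rw [forceTerm, tsum_fintype]
      have hd : ExpDominated B (forceTerm B e v k n) := hterm ▸ .sum _ (hdom n)
      exact ((((ExpDominated.const _).mul hd).mul (.exp J)).integrable hZ
        (((measurable_forceTerm hB k n).const_mul _).mul (hpair J).exp)).2.ne
    · intro n hn
      have h0 (φ : Φ) : forceTerm B e v k n φ = 0 := by
        simp [forceTerm, forceCoeff, hN (n + 1) (by simp at hn; omega)]
      simp [h0]

end GeneratingFunctional

/-! ### The Dyson–Schwinger equations -/

section DysonSchwinger

variable [mΦ : MeasurableSpace Φ] [Countable Λ] {B : Φ →ₗ[ℝ] 𝔍 →ₗ[ℝ] ℝ}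
  {G : 𝔍 →ₗ[ℝ] Φ} {γ μ : Measure Φ} {e : Λ → 𝔍} {v : (n : ℕ) → (Fin n → Λ) → ℝ}
  (hB : mΦ = cylinderSigmaAlgebra B)

include hB in
/-- Term-by-term integration of the force against an exponentially dominated weight. -/
lemma ConvergesInMean.hasSum_integral {k : Φ} (hk : ConvergesInMean B e v μ k) {W : Φ → ℝ}
    (hW : ExpDominated B W) (hm : Measurable W) :
    (∀ n, HasSum (fun p => forceCoeff B e v k n p * ∫ φ, (∏ j, B φ (e (p.2 j))) * W φ ∂μ)
      (∫ φ, forceTerm B e v k n φ * W φ ∂μ)) ∧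
    Integrable (fun φ => force B e v k φ * W φ) μ ∧
    HasSum (fun n : ℕ => (1 / (n.factorial : ℝ)) * ∫ φ, forceTerm B e v k n φ * W φ ∂μ)
      (∫ φ, force B e v k φ * W φ ∂μ) := by
  have hexp (J : 𝔍) : Measurable fun φ => Real.exp (B φ J) := (measurable_pairing hB J).exp
  refine ⟨fun n => ?_, ?_⟩
  · have hf (p : Λ × (Fin n → Λ)) :
        Measurable fun φ => forceCoeff B e v k n p * ∏ j, B φ (e (p.2 j)) :=
      (measurable_prod_pairing hB _ _).const_mul _
    have := (hasSum_integral_of_tsum_lintegral_ne_top (fun p => (hf p).fun_mul hm)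
      (hW.tsum_lintegral_ne_top hexp hf (hk.components · n))).2
    simp only [tsum_mul_right] at this
    simpa only [mul_assoc, integral_const_mul] using! this
  · have hf (n : ℕ) : Measurable fun φ => (1 / (n.factorial : ℝ)) * forceTerm B e v k n φ :=
      (measurable_forceTerm hB k n).const_mul _
    have := hasSum_integral_of_tsum_lintegral_ne_top (fun n => (hf n).fun_mul hm)
      (hW.tsum_lintegral_ne_top hexp hf hk.degrees)
    simp only [tsum_mul_right] at this
    simp only [mul_assoc, integral_const_mul] at this
    simpa only [mul_assoc] using! this

variable (hγ : IsGaussianState B G γ) (hsymm : ∀ J h, B (G J) h = B (G h) J)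
  (hv : IsAnalyticExpansion B e v)
  (hΞ : Integrable (fun φ => Real.exp (interaction B e v φ)) γ)
  (hμ : μ = γ.tilted (interaction B e v))
  (hZ : ∀ J, Integrable (fun φ => Real.exp (B φ J)) μ)
include hB hγ hsymm hv hΞ hμ hZ

/-- Integration by parts for the interacting state `μ`, that is, Gaussian integration by parts for
the function `W exp S_I`, whose derivative in the direction `k` is
`(W' + k_x F_I^x W) exp S_I`. -/
theorem integral_by_parts {h : 𝔍} (hk : ConvergesInMean B e v μ (G h)) {W W' : Φ → ℝ}
    (hW : ExpDominated B W) (hm : Measurable W) (hW' : ExpDominated B W') (hm' : Measurable W')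
    (hderiv : ∀ φ, HasLineDerivAt ℝ W (W' φ) φ (G h)) :
    ∫ φ, B φ h * W φ ∂μ = (∫ φ, W' φ ∂μ) + ∫ φ, force B e v (G h) φ * W φ ∂μ := by
  have hS : Measurable (interaction B e v) := measurable_interaction hB
  have hF : Measurable (force B e v (G h)) := measurable_force hB (G h)
  have hexp (s : ℝ) : ExpDominated B fun φ => Real.exp (s * B φ h) := by
    simpa using ExpDominated.exp (B := B) (s • h)
  have hexpm (s : ℝ) : Measurable fun φ => Real.exp (s * B φ h) :=
    ((measurable_pairing hB h).const_mul s).exp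
  have hFW {V : Φ → ℝ} (hV : ExpDominated B V) (hVm : Measurable V) :
      Integrable (fun φ => force B e v (G h) φ * V φ) μ := (hk.hasSum_integral hB hV hVm).2.1
  have toγ {g : Φ → ℝ} (hg : Integrable g μ) :
      Integrable (fun φ => Real.exp (interaction B e v φ) * g φ) γ :=
    (integrable_tilted_iff hΞ g).1 (hμ ▸ hg)
  have key := gaussian_integral_by_parts hB hγ hsymm
    (f := fun φ => W φ * Real.exp (interaction B e v φ))
    (f' := fun φ => (W' φ + force B e v (G h) φ * W φ) * Real.exp (interaction B e v φ))
    (hm.mul hS.exp) ((hm'.add (hF.mul hm)).mul hS.exp) h (fun φ => ?_) (fun s => ?_) fun s => ?_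
  · have tr (g : Φ → ℝ) : ∫ φ, g φ ∂μ = (∫ φ, Real.exp (interaction B e v φ) ∂γ)⁻¹ *
        ∫ φ, Real.exp (interaction B e v φ) * g φ ∂γ := by
      rw [hμ, integral_tilted, ← integral_const_mul]
      refine integral_congr_ae (ae_of_all _ fun φ => ?_)
      simp only [smul_eq_mul]
      ring
    rw [← integral_add (hW'.integrable hZ hm') (hFW hW hm), tr, tr]
    congr 1
    refine Eq.trans ?_ (key.trans ?_) <;>
    · refine integral_congr_ae (ae_of_all _ fun φ => ?_)
      simp only
      ring
  · have h1 := hderiv φ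
    have h2 := hasLineDerivAt_interaction hv φ (G h)
    unfold HasLineDerivAt at h1 h2 ⊢
    refine (h1.mul h2.exp).congr_deriv ?_
    simp only [zero_smul, add_zero]
    ring
  · refine (toγ ((hW.mul (hexp s)).integrable hZ (hm.mul (hexpm s)))).congr
      (ae_of_all _ fun φ => ?_)
    simp only
    ring
  · refine (toγ (((hW'.mul (hexp s)).integrable hZ (hm'.mul (hexpm s))).add
      (hFW (hW.mul (hexp s)) (hm.mul (hexpm s))))).congr (ae_of_all _ fun φ => ?_)
    simp only [Pi.add_apply]
    ring

/-- The Dyson–Schwinger equation with a general weight `W`: the expansion of the force under the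
integral is integrated term by term. -/
theorem dysonSchwinger_weighted {h : 𝔍} (hk : ConvergesInMean B e v μ (G h)) {W W' : Φ → ℝ}
    (hW : ExpDominated B W) (hm : Measurable W) (hW' : ExpDominated B W') (hm' : Measurable W')
    (hderiv : ∀ φ, HasLineDerivAt ℝ W (W' φ) φ (G h)) :
    (∀ n : ℕ, Summable fun p : Λ × (Fin n → Λ) => forceCoeff B e v (G h) n p *
      ∫ φ, (∏ j, B φ (e (p.2 j))) * W φ ∂μ) ∧
    (Summable fun n : ℕ => (1 / (n.factorial : ℝ)) *
      ∑' p : Λ × (Fin n → Λ), forceCoeff B e v (G h) n p *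
        ∫ φ, (∏ j, B φ (e (p.2 j))) * W φ ∂μ) ∧
    ∫ φ, B φ h * W φ ∂μ = (∫ φ, W' φ ∂μ) + ∑' n : ℕ, (1 / (n.factorial : ℝ)) *
      ∑' p : Λ × (Fin n → Λ), forceCoeff B e v (G h) n p *
        ∫ φ, (∏ j, B φ (e (p.2 j))) * W φ ∂μ := by
  obtain ⟨hp, -, hn⟩ := hk.hasSum_integral hB hW hm
  simp only [(hp _).tsum_eq]
  refine ⟨fun n => (hp n).summable, hn.summable, ?_⟩
  rw [hn.tsum_eq]
  exact integral_by_parts hB hγ hsymm hv hΞ hμ hZ hk hW hm hW' hm' hderiv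

/-- The case `W = exp ⟨φ, J⟩`, where the moments of `W μ` are functional derivatives of `Z`. -/
theorem dysonSchwinger_genFun {h : 𝔍} (hk : ConvergesInMean B e v μ (G h)) (J : 𝔍) :
    (∀ n : ℕ, Summable fun p : Λ × (Fin n → Λ) => forceCoeff B e v (G h) n p *
      iterDeriv (fun j => e (p.2 j)) (genFun B μ) J) ∧
    (Summable fun n : ℕ => (1 / (n.factorial : ℝ)) *
      forceOpTerm B e v (G h) n (genFun B μ) J) ∧
    lineDeriv ℝ (genFun B μ) J h = B (G h) J * genFun B μ J +
      ∑' n : ℕ, (1 / (n.factorial : ℝ)) * forceOpTerm B e v (G h) n (genFun B μ) J := by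
  have hm : Measurable fun φ => Real.exp (B φ J) := (measurable_pairing hB J).exp
  have hZh : lineDeriv ℝ (genFun B μ) J h = ∫ φ, B φ h * Real.exp (B φ J) ∂μ := by
    simpa [iterDeriv] using congrFun (iterDeriv_genFun hB hZ fun _ : Fin 1 => h) J
  simp only [forceOpTerm, iterDeriv_genFun hB hZ]
  have hderiv (φ : Φ) : HasLineDerivAt ℝ (fun φ => Real.exp (B φ J))
      (B (G h) J * Real.exp (B φ J)) φ (G h) := by
    have := (((hasDerivAt_id (0 : ℝ)).mul_const (B (G h) J)).const_add (B φ J)).exp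
    simp only [HasLineDerivAt, map_add, map_smul, LinearMap.add_apply, LinearMap.smul_apply,
      smul_eq_mul]
    refine this.congr_deriv ?_
    simp [mul_comm]
  obtain ⟨h₁, h₂, h₃⟩ := dysonSchwinger_weighted hB hγ hsymm hv hΞ hμ hZ hk (.exp J) hm
    ((ExpDominated.const _).mul (.exp J)) (hm.const_mul _) hderiv
  refine ⟨h₁, h₂, ?_⟩
  rw [hZh, h₃, integral_const_mul]
  rfl

/-- The case `W = ∏ᵢ φ(Kᵢ)`, whose derivative in the direction `G h` is given by the product
rule. -/
theorem dysonSchwinger_moments {h : 𝔍} (hk : ConvergesInMean B e v μ (G h)) {m : ℕ}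
    (K : Fin m → 𝔍) :
    (∀ n : ℕ, Summable fun p : Λ × (Fin n → Λ) => forceCoeff B e v (G h) n p *
      ∫ φ, (∏ j, B φ (e (p.2 j))) * ∏ i, B φ (K i) ∂μ) ∧
    (Summable fun n : ℕ => (1 / (n.factorial : ℝ)) *
      ∑' p : Λ × (Fin n → Λ), forceCoeff B e v (G h) n p *
        ∫ φ, (∏ j, B φ (e (p.2 j))) * ∏ i, B φ (K i) ∂μ) ∧
    ∫ φ, B φ h * ∏ i, B φ (K i) ∂μ =
      (∑ i, B (G h) (K i) * ∫ φ, ∏ j ∈ Finset.univ.erase i, B φ (K j) ∂μ) +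
      ∑' n : ℕ, (1 / (n.factorial : ℝ)) *
        ∑' p : Λ × (Fin n → Λ), forceCoeff B e v (G h) n p *
          ∫ φ, (∏ j, B φ (e (p.2 j))) * ∏ i, B φ (K i) ∂μ := by
  have hd (s : Finset (Fin m)) : ExpDominated B fun φ => ∏ i ∈ s, B φ (K i) :=
    .prod s fun i => .pairing _
  have hm (s : Finset (Fin m)) := measurable_prod_pairing hB s K
  have hsum : ∑ i, B (G h) (K i) * ∫ φ, ∏ j ∈ Finset.univ.erase i, B φ (K j) ∂μ =
      ∫ φ, ∑ i, B (G h) (K i) * ∏ j ∈ Finset.univ.erase i, B φ (K j) ∂μ := by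
    simp only [← integral_const_mul]
    exact (integral_finsetSum _ fun i _ => ((hd _).integrable hZ (hm _)).const_mul _).symm
  rw [hsum]
  refine dysonSchwinger_weighted hB hγ hsymm hv hΞ hμ hZ hk (hd _) (hm _)
    (.sum _ fun i => (ExpDominated.const _).mul (hd _))
    (Finset.measurable_fun_sum _ fun i _ => (hm _).const_mul _) fun φ => ?_
  have := HasDerivAt.fun_finsetProd (u := Finset.univ) (f := fun i (t : ℝ) => B (φ + t • G h) (K i))
    (f' := fun i => B (G h) (K i)) (x := 0) fun i _ => by
      simpa using ((hasDerivAt_id (0 : ℝ)).mul_const (B (G h) (K i))).const_add (B φ (K i))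
  refine HasDerivAt.congr_deriv this ?_
  simp [mul_comm]

end DysonSchwinger

end FieldTheory

theorem mainTheorem4 {Φ 𝔍 Λ : Type*} [AddCommGroup Φ] [Module ℝ Φ] [AddCommGroup 𝔍] [Module ℝ 𝔍]
    [Countable Λ] [mΦ : MeasurableSpace Φ]
    (B : Φ →ₗ[ℝ] 𝔍 →ₗ[ℝ] ℝ) (hB : mΦ = FieldTheory.cylinderSigmaAlgebra B) (e : Λ → 𝔍)
    (L : Φ →ₗ.[ℝ] 𝔍) (G : 𝔍 →ₗ[ℝ] Φ)
    (hL : FieldTheory.IsSymmetricOperator B L) (hG : FieldTheory.IsInverseOperator L G)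
    (γ : Measure Φ) (hγ : FieldTheory.IsGaussianState B G γ)
    (v : (n : ℕ) → (Fin n → Λ) → ℝ) (hv : FieldTheory.IsAnalyticExpansion B e v)
    (hΞ : Integrable (fun φ => Real.exp (FieldTheory.interaction B e v φ)) γ)
    (μ : Measure Φ) (hμ : μ = γ.tilted (FieldTheory.interaction B e v))
    (hZ : ∀ J, Integrable (fun φ => Real.exp (B φ J)) μ) :
    -- `F` is the gradient of the action
    (∀ φ k : Φ, HasLineDerivAt ℝ (FieldTheory.interaction B e v)
      (FieldTheory.force B e v k φ) φ k) ∧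
    (∀ φ k : L.domain, HasLineDerivAt ℝ (FieldTheory.totalAction B L e v)
      (-B φ (L k) + FieldTheory.force B e v k φ) φ k) ∧
    -- all functional derivatives of `Z` and all moments exist
    (∀ (n : ℕ) (h : Fin n → 𝔍) (J h' : 𝔍),
      LineDifferentiableAt ℝ (FieldTheory.iterDeriv h (FieldTheory.genFun B μ)) J h') ∧
    (∀ (m : ℕ) (K : Fin m → 𝔍), Integrable (fun φ => ∏ i, B φ (K i)) μ) ∧
    -- the convergence condition used below holds for polynomial interactions of finitely many fields
    (Finite Λ → (∃ N : ℕ, ∀ n, N ≤ n → ∀ y, v n y = 0) →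
      ∀ k : Φ, FieldTheory.ConvergesInMean B e v μ k) ∧
    -- the differential equation
    (∀ k : L.domain, FieldTheory.ConvergesInMean B e v μ k → ∀ J : 𝔍,
      (∀ n : ℕ, Summable fun p : Λ × (Fin n → Λ) => FieldTheory.forceCoeff B e v k n p *
        FieldTheory.iterDeriv (fun j => e (p.2 j)) (FieldTheory.genFun B μ) J) ∧
      (Summable fun n : ℕ => (1 / (n.factorial : ℝ)) *
        FieldTheory.forceOpTerm B e v k n (FieldTheory.genFun B μ) J) ∧
      FieldTheory.totalForceOp B L e v k (FieldTheory.genFun B μ) J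
        + B k J * FieldTheory.genFun B μ J = 0) ∧
    -- the hierarchy of equations for the moments
    (∀ h : 𝔍, FieldTheory.ConvergesInMean B e v μ (G h) → ∀ (m : ℕ) (K : Fin m → 𝔍),
      (∀ n : ℕ, Summable fun p : Λ × (Fin n → Λ) => FieldTheory.forceCoeff B e v (G h) n p *
        ∫ φ, (∏ j, B φ (e (p.2 j))) * ∏ i, B φ (K i) ∂μ) ∧
      (Summable fun n : ℕ => (1 / (n.factorial : ℝ)) *
        ∑' p : Λ × (Fin n → Λ), FieldTheory.forceCoeff B e v (G h) n p *
          ∫ φ, (∏ j, B φ (e (p.2 j))) * ∏ i, B φ (K i) ∂μ) ∧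
      ∫ φ, B φ h * ∏ i, B φ (K i) ∂μ =
        (∑ i, B (G h) (K i) * ∫ φ, ∏ j ∈ Finset.univ.erase i, B φ (K j) ∂μ) +
        ∑' n : ℕ, (1 / (n.factorial : ℝ)) *
          ∑' p : Λ × (Fin n → Λ), FieldTheory.forceCoeff B e v (G h) n p *
            ∫ φ, (∏ j, B φ (e (p.2 j))) * ∏ i, B φ (K i) ∂μ) := by
  have hsymm := FieldTheory.inverse_symmetric hL hG
  refine ⟨FieldTheory.hasLineDerivAt_interaction hv, FieldTheory.hasLineDerivAt_totalAction hv hL,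
    fun n h J h' => FieldTheory.lineDifferentiableAt_iterDeriv_genFun hB hZ h J h',
    fun m K => (FieldTheory.ExpDominated.prod _ fun i => .pairing (K i)).integrable hZ
      (FieldTheory.measurable_prod_pairing hB _ K),
    fun _ ⟨N, hN⟩ k => FieldTheory.convergesInMean_of_finite hB hZ hN k, fun k hk J => ?_,
    fun h hk m K => FieldTheory.dysonSchwinger_moments hB hγ hsymm hv hΞ hμ hZ hk K⟩
  have hGk : G (L k) = k := hG.inverse_apply k
  obtain ⟨h₁, h₂, h₃⟩ :=
    FieldTheory.dysonSchwinger_genFun hB hγ hsymm hv hΞ hμ hZ (hGk.symm ▸ hk) J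
  rw [hGk] at h₃
  simp only [hGk] at h₁ h₂
  refine ⟨h₁, h₂, ?_⟩
  rw [FieldTheory.totalForceOp, h₃]
  ring
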